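/- Let $d\in\mathbb{N}$, $d\ge 1$, $H\in(0,1)$ and $p,q\in[1,\infty)$ be such that $$\frac{1-H}{q}+\frac{Hd}{p}>1-H .$$ Then for every $x\in\mathbb{R}^d$ there exists a Borel function $b\colon[0,1]\times\mathbb{R}^d\to\mathbb{R}^d$ in $L_q([0,1],L_p(\mathbb{R}^d))$, that is, with $\int_0^1\|b_t\|_{L_p(\mathbb{R}^d)}^q\,dt<\infty$, such that the equation $$X_t=x+\int_0^t b_r(X_r)\,dr+W^H_t,\qquad t\in[0,1],\tag{1}$$ where $W^H$ is a $d$-dimensional fractional Brownian motion of Hurst parameter $H$, has no weak solution. Here a weak solution of (1) is a pair $(X,W^H)$ of $\mathbb{R}^d$-valued processes on a complete filtered probability space $(\Omega,\mathcal F,\mathbb F=(\mathcal F_t)_{t\in[0,1]},\mathbb P)$ such that $W^H$ is an $\mathbb F$-fractional Brownian motion of Hurst parameter $H$, $X$ is continuous and adapted to $\mathbb F$, and almost surely the function $r\mapsto b_r(X_r)$ is Lebesgue integrable on $[0,1]$ and (1) holds for all $t\in[0,1]$. An $\mathbb F$-fractional Brownian motion is a fractional Brownian motion $W^H$ (a continuous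 centered Gaussian process with independent coordinates, each of covariance $\frac12(s^{2H}+t^{2H}-|t-s|^{2H})$) for which there is a $d$-dimensional $\mathbb F$-Brownian motion $B$ with $W^H_t=\int_0^tK_H(t,s)\,dB_s$ for every $t\in[0,1]$, where for $0<s<t$ $$K_H(t,s)=C\,s^{\frac12-H}\int_s^t(r-s)^{H-\frac32}r^{H-\frac12}\,dr\quad\text{if }H>\tfrac12,$$ $$K_H(t,s)=C\Bigl(t^{H-\frac12}s^{\frac12-H}(t-s)^{H-\frac12}+\bigl(\tfrac12-H\bigr)s^{\frac12-H}\int_s^t(r-s)^{H-\frac12}r^{H-\frac32}\,dr\Bigr)\quad\text{if }H\le\tfrac12,$$ and $C>0$ is the normalizing constant. -/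

import Mathlib

universe u

noncomputable section

open MeasureTheory ProbabilityTheory Filter Topology unitInterval
open scoped ENNReal NNReal

namespace FractionalSDE

/-- Euclidean space `ℝ^d`. -/
abbrev E (d : ℕ) : Type := EuclideanSpace ℝ (Fin d)

/-- A Borel function `b : [0,1] × ℝ^d → ℝ^d` belongs to `L_q([0,1], L_p(ℝ^d))`, that is,
`∫_0^1 ‖b_t‖_{L_p(ℝ^d)}^q dt < ∞`. -/
def MemMixedLp {d : ℕ} (q p : ℝ) (b : I → E d → E d) : Prop :=
  Measurable (Function.uncurry b) ∧
    eLpNorm (fun t : I => eLpNorm (b t) (ENNReal.ofReal p) volume) (ENNReal.ofReal q) volume < ∞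

/-- The Volterra kernel `K_H(t, s)`, `0 < s < t`, of fractional Brownian motion of Hurst
parameter `H`, without its normalizing constant. -/
def volterraKernel (H t s : ℝ) : ℝ :=
  if 1 / 2 < H then
    s ^ (1 / 2 - H) * ∫ r in s..t, (r - s) ^ (H - 3 / 2) * r ^ (H - 1 / 2)
  else
    t ^ (H - 1 / 2) * s ^ (1 / 2 - H) * (t - s) ^ (H - 1 / 2) +
      (1 / 2 - H) * s ^ (1 / 2 - H) * ∫ r in s..t, (r - s) ^ (H - 1 / 2) * r ^ (H - 3 / 2)

/-- A step function `∑ k, c k * 𝟙_{(u k, v k]}` on `[0,1]`. -/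
structure StepFunction where
  n : ℕ
  c : Fin n → ℝ
  u : Fin n → I
  v : Fin n → I
  le : ∀ k, u k ≤ v k

/-- The value of a step function at a point. -/
def StepFunction.eval (φ : StepFunction) (s : I) : ℝ :=
  ∑ k, (Set.Ioc (φ.u k) (φ.v k)).indicator (fun _ => φ.c k) s

/-- The elementary integral `∫ φ dB = ∑ k, c k • (B (v k) - B (u k))`. -/
def StepFunction.integral {d : ℕ} {Ω : Type*} (φ : StepFunction) (B : I → Ω → E d) (ω : Ω) : E d :=
  ∑ k, φ.c k • (B (φ.v k) ω - B (φ.u k) ω)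

/-- `Y` is the Wiener integral `∫_0^1 g(s) dB_s` of the deterministic function `g`: the limit in
`L²(P)` of elementary integrals of step functions that converge to `g` in `L²([0,1])`. -/
def IsWienerIntegral {d : ℕ} {Ω : Type*} [MeasurableSpace Ω] (P : Measure Ω)
    (B : I → Ω → E d) (g : I → ℝ) (Y : Ω → E d) : Prop :=
  ∃ φ : ℕ → StepFunction,
    Tendsto (fun n => eLpNorm (fun s => (φ n).eval s - g s) 2 volume) atTop (𝓝 0) ∧
    Tendsto (fun n => eLpNorm (fun ω => (φ n).integral B ω - Y ω) 2 P) atTop (𝓝 0)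

/-- `B` is a standard `d`-dimensional Brownian motion on `[0,1]` relative to the filtration `F`. -/
structure IsBrownianMotion {d : ℕ} {Ω : Type*} {m : MeasurableSpace Ω} (P : Measure Ω)
    (F : Filtration I m) (B : I → Ω → E d) : Prop where
  adapted : Adapted F B
  zero : ∀ᵐ ω ∂P, B 0 ω = 0
  continuous : ∀ᵐ ω ∂P, Continuous fun t => B t ω
  law : ∀ s t : I, s ≤ t →
    HasLaw (fun ω => B t ω - B s ω)
      (multivariateGaussian (0 : E d) (((t : ℝ) - s) • (1 : Matrix (Fin d) (Fin d) ℝ))) P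
  indep : ∀ s t : I, s ≤ t →
    Indep (MeasurableSpace.comap (fun ω => B t ω - B s ω) inferInstance) (F s) P

/-- `W` is a `d`-dimensional fractional Brownian motion on `[0,1]` of Hurst parameter `H`: a
continuous centered Gaussian process with independent coordinates, each of covariance
`(s^{2H} + t^{2H} - |t - s|^{2H}) / 2`. -/
structure IsFBM {d : ℕ} {Ω : Type*} [MeasurableSpace Ω] (P : Measure Ω) (H : ℝ)
    (W : I → Ω → E d) : Prop where
  gaussian : IsGaussianProcess W P
  mean : ∀ t, P[W t] = 0
  cov : ∀ (s t : I) (i j : Fin d),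
    cov[fun ω => W s ω i, fun ω => W t ω j; P] =
      if i = j then
        ((s : ℝ) ^ (2 * H) + (t : ℝ) ^ (2 * H) - |(t : ℝ) - s| ^ (2 * H)) / 2
      else 0
  continuous : ∀ᵐ ω ∂P, Continuous fun t => W t ω

/-- `W` is an `F`-fractional Brownian motion: a fractional Brownian motion for which there is an
`F`-Brownian motion `B` with `W_t = ∫_0^t K_H(t,s) dB_s`. The constant `C` is the normalizing
constant of `K_H`; its value is determined by the covariance of `W`. -/
def IsAdaptedFBM {d : ℕ} {Ω : Type*} {m : MeasurableSpace Ω} (P : Measure Ω)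
    (F : Filtration I m) (H : ℝ) (W : I → Ω → E d) : Prop :=
  IsFBM P H W ∧
    ∃ B : I → Ω → E d, IsBrownianMotion P F B ∧ ∃ C : ℝ, 0 < C ∧ ∀ t : I,
      IsWienerIntegral P B
        ((Set.Iio t).indicator fun s : I => C * volterraKernel H (t : ℝ) (s : ℝ)) (W t)

/-- `(X, W)`, on the filtered probability space `(Ω, m, F, P)`, is a weak solution of
`X_t = x + ∫_0^t b_r(X_r) dr + W_t`, `t ∈ [0,1]`, the integral being a Lebesgue integral. -/
structure IsWeakSolution {d : ℕ} {Ω : Type*} {m : MeasurableSpace Ω} (P : Measure Ω)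
    (F : Filtration I m) (H : ℝ) (x : E d) (b : I → E d → E d) (X W : I → Ω → E d) : Prop where
  prob : IsProbabilityMeasure P
  /-- The space is complete: all null sets (outer measure zero) belong to every `F t`, hence
  to `m`. -/
  complete : ∀ (t : I) (N : Set Ω), P N = 0 → MeasurableSet[F t] N
  fbm : IsAdaptedFBM P F H W
  adapted : Adapted F X
  continuous : ∀ᵐ ω ∂P, Continuous fun t => X t ω
  equation : ∀ᵐ ω ∂P, Integrable (fun r : I => b r (X r ω)) volume ∧
    ∀ t : I, X t ω = x + (∫ r in Set.Iic t, b r (X r ω)) + W t ω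

/-- The equation has a weak solution on some complete filtered probability space. -/
def HasWeakSolution {d : ℕ} (H : ℝ) (x : E d) (b : I → E d → E d) : Prop :=
  ∃ (Ω : Type u) (m : MeasurableSpace Ω) (P : Measure Ω) (F : Filtration I m)
    (X W : I → Ω → E d), IsWeakSolution P F H x b X W

end FractionalSDE

end

/-
After translating `x` to the origin, the drift `b_t(y) = -t^{-β} ‖y‖^{-α} y / ‖y‖` near `y = 0`,
with `α < d / p` and `β < 1 / q`, attracts the solution so strongly that the noise cannot escape.
If `u` is a time at which `‖X - x‖` reaches a new maximum `R`, then during the last part of the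
excursion, of length `τ`, an `h`-Hölder noise, `h < H`, has to produce both the displacement `R` and
the drift `τ R^{-α} u^{-β}`, up to constants. Eliminating `τ` gives `‖X_t - x‖ = O(t^γ)` as `t → 0`
with `γ = β h / (1 - h - α h)`. Cleared of its denominators, the condition `γ > H / (1 - H)` becomes
`(1 - H) / q + H d / p > 1 - H` in the limit `h → H`, `α → d / p`, `β → 1 / q`.

By the equation, the variation of `W` along the first `m` steps of a grid of mesh `m^{-1/H}` is at
most `2 m` times the maximum of `‖X - x‖` on `[0, m^{1-1/H}]`, plus the integral of `‖b_r(X_r)‖`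
over this interval. Since `γ > H / (1 - H)`, both tend to `0`. But by scaling the mean of this
variation is a positive constant, and its second moments are bounded, so it cannot tend to `0`
almost surely.
-/

noncomputable section

open MeasureTheory ProbabilityTheory Filter Topology unitInterval
open scoped ENNReal NNReal

namespace FractionalSDE

section DyadicChaining

variable {S : Type*} [PseudoMetricSpace S] {F : ℝ → S} {K ρ : ℝ}

lemma dist_floor_succ_le_of_dist_dyadic_le
    (hdyadic : ∀ n j : ℕ, dist (F (j / 2 ^ n)) (F ((j + 1) / 2 ^ n)) ≤ K * ρ ^ n)
    (u : ℝ) (m : ℕ) :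
    dist (F (⌊2 ^ m * u⌋₊ / 2 ^ m)) (F (⌊2 ^ (m + 1) * u⌋₊ / 2 ^ (m + 1))) ≤
      K * ρ ^ (m + 1) := by
  have hfloor : ⌊(2 : ℝ) ^ m * u⌋₊ = ⌊(2 : ℝ) ^ (m + 1) * u⌋₊ / 2 := by
    rw [← Nat.floor_div_natCast]
    congr 1
    push_cast
    ring
  have hcoarse (k : ℕ) : (k : ℝ) / 2 ^ m = (2 * k : ℕ) / 2 ^ (m + 1) := by
    push_cast
    field_simp
    ring
  obtain ⟨k, heven | hodd⟩ := Nat.even_or_odd' ⌊(2 : ℝ) ^ (m + 1) * u⌋₊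
  · rw [hfloor, heven, Nat.mul_div_cancel_left k two_pos, hcoarse, dist_self]
    exact dist_nonneg.trans (hdyadic (m + 1) 0)
  · rw [hfloor, hodd, show (2 * k + 1) / 2 = k by omega, hcoarse, Nat.cast_succ]
    exact hdyadic (m + 1) (2 * k)

lemma dist_floor_le_of_dist_dyadic_le (hF : Continuous F) (hρ : ρ < 1)
    (hdyadic : ∀ n j : ℕ, dist (F (j / 2 ^ n)) (F ((j + 1) / 2 ^ n)) ≤ K * ρ ^ n)
    {u : ℝ} (hu : 0 ≤ u) (n : ℕ) :
    dist (F (⌊2 ^ n * u⌋₊ / 2 ^ n)) (F u) ≤ K * ρ * ρ ^ n / (1 - ρ) := by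
  refine dist_le_of_le_geometric_of_tendsto (f := fun n : ℕ => F (⌊2 ^ n * u⌋₊ / 2 ^ n)) ρ (K * ρ)
    hρ (fun m => ?_) ?_ n
  · rw [mul_assoc, ← pow_succ']
    exact dist_floor_succ_le_of_dist_dyadic_le hdyadic u m
  · have hpow : Tendsto (fun n : ℕ => (2 : ℝ) ^ n) atTop atTop :=
      tendsto_pow_atTop_atTop_of_one_lt one_lt_two
    refine (hF.tendsto u).comp (((tendsto_nat_floor_mul_div_atTop hu).comp hpow).congr fun n => ?_)
    simp only [Function.comp_apply, mul_comm]

lemma dist_le_of_dist_dyadic_le (hF : Continuous F) (hρ : ρ < 1)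
    (hdyadic : ∀ n j : ℕ, dist (F (j / 2 ^ n)) (F ((j + 1) / 2 ^ n)) ≤ K * ρ ^ n)
    {s t : ℝ} (hs : 0 ≤ s) (hst : s ≤ t) {n : ℕ} (hts : t - s ≤ (1 / 2) ^ n) :
    dist (F s) (F t) ≤ K * (1 + ρ) / (1 - ρ) * ρ ^ n := by
  have hfloor_le : ⌊(2 : ℝ) ^ n * s⌋₊ ≤ ⌊(2 : ℝ) ^ n * t⌋₊ := Nat.floor_mono (by gcongr)
  have hle_floor : ⌊(2 : ℝ) ^ n * t⌋₊ ≤ ⌊(2 : ℝ) ^ n * s⌋₊ + 1 := by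
    rw [← Nat.floor_add_one (by positivity)]
    refine Nat.floor_mono ?_
    have : (2 : ℝ) ^ n * (t - s) ≤ 2 ^ n * (1 / 2) ^ n := by gcongr
    rw [← mul_pow, mul_one_div_cancel two_ne_zero, one_pow] at this
    linarith
  have hmid : dist (F (⌊2 ^ n * s⌋₊ / 2 ^ n)) (F (⌊2 ^ n * t⌋₊ / 2 ^ n)) ≤ K * ρ ^ n := by
    obtain heq | heq : ⌊(2 : ℝ) ^ n * t⌋₊ = ⌊(2 : ℝ) ^ n * s⌋₊ ∨
      ⌊(2 : ℝ) ^ n * t⌋₊ = ⌊(2 : ℝ) ^ n * s⌋₊ + 1 := by omega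
    · rw [heq, dist_self]
      exact dist_nonneg.trans (hdyadic n 0)
    · rw [heq, Nat.cast_succ]
      exact hdyadic n _
  calc dist (F s) (F t)
      ≤ dist (F s) (F (⌊2 ^ n * s⌋₊ / 2 ^ n)) +
          dist (F (⌊2 ^ n * s⌋₊ / 2 ^ n)) (F (⌊2 ^ n * t⌋₊ / 2 ^ n)) +
          dist (F (⌊2 ^ n * t⌋₊ / 2 ^ n)) (F t) := dist_triangle4 _ _ _ _
    _ ≤ K * ρ * ρ ^ n / (1 - ρ) + K * ρ ^ n + K * ρ * ρ ^ n / (1 - ρ) := by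
      rw [dist_comm (F s)]
      gcongr
      · exact dist_floor_le_of_dist_dyadic_le hF hρ hdyadic hs n
      · exact dist_floor_le_of_dist_dyadic_le hF hρ hdyadic (hs.trans hst) n
    _ = K * (1 + ρ) / (1 - ρ) * ρ ^ n := by
      have : 1 - ρ ≠ 0 := by linarith
      field_simp
      ring

lemma dist_le_rpow_of_dist_dyadic_le {h : ℝ} (hF : Continuous F) (hh : 0 < h)
    (hdyadic : ∀ n j : ℕ, dist (F (j / 2 ^ n)) (F ((j + 1) / 2 ^ n)) ≤ K * ((2 : ℝ) ^ (-h)) ^ n)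
    {s t : ℝ} (hs : 0 ≤ s) (hst : s ≤ t) (ht : t ≤ s + 1) :
    dist (F s) (F t) ≤
      K * (1 + (2 : ℝ) ^ (-h)) / (1 - (2 : ℝ) ^ (-h)) * 2 ^ h * (t - s) ^ h := by
  set ρ : ℝ := (2 : ℝ) ^ (-h) with hρ
  have hρ1 : ρ < 1 := Real.rpow_lt_one_of_one_lt_of_neg one_lt_two (neg_lt_zero.2 hh)
  have hK : 0 ≤ K := by simpa using dist_nonneg.trans (hdyadic 0 0)
  obtain rfl | hlt := hst.eq_or_lt
  · simp [Real.zero_rpow hh.ne']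
  obtain ⟨n, hn_lt, hn_le⟩ := exists_nat_pow_near_of_lt_one (x := t - s) (y := (1 / 2 : ℝ))
    (by linarith) (by linarith) (by norm_num) (by norm_num)
  have hρn : ρ ^ n ≤ 2 ^ h * (t - s) ^ h := by
    calc ρ ^ n = ((1 / 2 : ℝ) ^ n) ^ h := by
          rw [hρ, Real.rpow_neg zero_le_two, ← Real.inv_rpow zero_le_two, one_div,
            Real.rpow_pow_comm (by norm_num)]
      _ ≤ (2 * (t - s)) ^ h := by
        gcongr
        rw [pow_succ] at hn_lt
        linarith
      _ = 2 ^ h * (t - s) ^ h := Real.mul_rpow zero_le_two (by linarith)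
  have : 0 < 1 - ρ := by linarith
  calc dist (F s) (F t) ≤ K * (1 + ρ) / (1 - ρ) * ρ ^ n :=
        dist_le_of_dist_dyadic_le hF hρ1 hdyadic hs hst hn_le
    _ ≤ K * (1 + ρ) / (1 - ρ) * (2 ^ h * (t - s) ^ h) := by gcongr
    _ = _ := by ring

lemma exists_holderWith_of_dist_dyadic_le {w : I → S} {h : ℝ≥0} (hw : Continuous w) (hh : 0 < h)
    (hdyadic : ∀ n j : ℕ, dist (w (Set.projIcc 0 1 zero_le_one (j / 2 ^ n)))
      (w (Set.projIcc 0 1 zero_le_one ((j + 1) / 2 ^ n))) ≤ K * ((2 : ℝ) ^ (-h : ℝ)) ^ n) :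
    ∃ C : ℝ≥0, HolderWith C h w := by
  set L : ℝ := K * (1 + (2 : ℝ) ^ (-h : ℝ)) / (1 - (2 : ℝ) ^ (-h : ℝ)) * 2 ^ (h : ℝ)
  refine ⟨L.toNNReal, fun s t => ?_⟩
  wlog hst : s ≤ t generalizing s t
  · rw [edist_comm, edist_comm s]
    exact this t s (le_of_not_ge hst)
  have hdist := dist_le_rpow_of_dist_dyadic_le (F := Set.IccExtend zero_le_one w) hw.Icc_extend'
    hh hdyadic s.2.1 (t := t) hst (by linarith [s.2.1, t.2.2])
  rw [Set.IccExtend_val, Set.IccExtend_val,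
    ← abs_of_nonneg (sub_nonneg.2 (Subtype.coe_le_coe.2 hst)), abs_sub_comm,
    ← Real.dist_eq, ← Subtype.dist_eq] at hdist
  calc edist (w s) (w t) ≤ ENNReal.ofReal (L * dist s t ^ (h : ℝ)) := by
        rw [edist_dist]
        exact ENNReal.ofReal_le_ofReal hdist
    _ = L.toNNReal * edist s t ^ (h : ℝ) := by
        rw [ENNReal.ofReal_mul' (by positivity), ENNReal.ofReal, edist_dist,
          ENNReal.ofReal_rpow_of_nonneg dist_nonneg h.coe_nonneg]

end DyadicChaining

section Kolmogorov

variable {Ω : Type*} [MeasurableSpace Ω] {P : Measure Ω}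

lemma ae_exists_forall_le_mul_of_tsum_lintegral_ne_top {ι : Type*} [Countable ι]
    {f : ι → Ω → ℝ≥0∞} {a : ι → ℝ≥0} {p : ℝ} (hp : 0 < p) (hf : ∀ i, AEMeasurable (f i) P)
    (ha : ∀ i, a i ≠ 0) (hsum : ∑' i, (∫⁻ ω, f i ω ^ p ∂P) / a i ^ p ≠ ∞) :
    ∀ᵐ ω ∂P, ∃ K : ℝ≥0, ∀ i, f i ω ≤ K * a i := by
  have hmeas : ∀ i, AEMeasurable (fun ω => (f i ω / a i) ^ p) P := fun i => by fun_prop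
  have hlintegral : ∫⁻ ω, ∑' i, (f i ω / a i) ^ p ∂P ≠ ∞ := by
    rw [lintegral_tsum hmeas]
    convert! hsum using 3 with i
    simp_rw [ENNReal.div_rpow_of_nonneg _ _ hp.le, div_eq_mul_inv]
    exact lintegral_mul_const'' _ ((hf i).pow_const p)
  filter_upwards [ae_lt_top' (AEMeasurable.tsum hmeas) hlintegral] with ω hω
  refine ⟨((∑' i, (f i ω / a i) ^ p) ^ p⁻¹).toNNReal, fun i => ?_⟩
  rw [ENNReal.coe_toNNReal (ENNReal.rpow_ne_top_of_nonneg (by positivity) hω.ne),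
    ← ENNReal.div_le_iff (by simpa using ha i) ENNReal.coe_ne_top,
    ENNReal.le_rpow_inv_iff hp]
  exact ENNReal.le_tsum i

variable {S : Type*} [PseudoMetricSpace S] {X : I → Ω → S} {p q : ℝ} {M : ℝ≥0}

lemma lintegral_edist_dyadic_rpow_le (hX : IsAEKolmogorovProcess X P p q M) (n j : ℕ) :
    ∫⁻ ω, edist (X (Set.projIcc 0 1 zero_le_one (j / 2 ^ n)) ω)
      (X (Set.projIcc 0 1 zero_le_one ((j + 1) / 2 ^ n)) ω) ^ p ∂P ≤
        M * ((2 : ℝ≥0∞) ^ (-q)) ^ n := by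
  refine (hX.kolmogorovCondition _ _).trans ?_
  have hedist : edist (Set.projIcc (0 : ℝ) 1 zero_le_one (j / 2 ^ n))
      (Set.projIcc 0 1 zero_le_one ((j + 1) / 2 ^ n)) ≤ 2⁻¹ ^ n := by
    refine (LipschitzWith.projIcc zero_le_one _ _).trans ?_
    rw [edist_dist, Real.dist_eq, ← sub_div, sub_add_cancel_left, abs_div, abs_neg, abs_one,
      abs_of_pos (by positivity), ENNReal.coe_one, one_mul, one_div, ← inv_pow,
      ENNReal.ofReal_pow (by positivity), ENNReal.ofReal_inv_of_pos two_pos, ENNReal.ofReal_ofNat]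
  calc M * edist (Set.projIcc (0 : ℝ) 1 zero_le_one (j / 2 ^ n))
        (Set.projIcc 0 1 zero_le_one ((j + 1) / 2 ^ n)) ^ q
      ≤ M * (2⁻¹ ^ n) ^ q := by gcongr; exact hX.q_pos.le
    _ = M * ((2 : ℝ≥0∞) ^ (-q)) ^ n := by
      rw [← ENNReal.rpow_natCast_mul, mul_comm (n : ℝ), ENNReal.rpow_mul_natCast, ENNReal.inv_rpow,
        ENNReal.rpow_neg]

lemma tsum_lintegral_edist_dyadic_ne_top (hX : IsAEKolmogorovProcess X P p q M) {h : ℝ}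
    (hpq : h * p + 1 < q) :
    ∑' i : Σ n : ℕ, Fin (2 ^ n),
      (∫⁻ ω, edist (X (Set.projIcc 0 1 zero_le_one (i.2 / 2 ^ i.1)) ω)
        (X (Set.projIcc 0 1 zero_le_one ((i.2 + 1) / 2 ^ i.1)) ω) ^ p ∂P) /
          (((2 : ℝ≥0) ^ (-h)) ^ i.1 : ℝ≥0) ^ p ≠ ∞ := by
  have hratio : (2 : ℝ≥0∞) ^ (1 - q + h * p) < 1 :=
    ENNReal.rpow_lt_one_of_one_lt_of_neg (by norm_num) (by linarith)
  refine ne_top_of_le_ne_top (b := ∑' n, M * ((2 : ℝ≥0∞) ^ (1 - q + h * p)) ^ n) ?_ ?_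
  · rw [ENNReal.tsum_mul_left, ENNReal.tsum_geometric]
    exact ENNReal.mul_ne_top ENNReal.coe_ne_top (by simpa [tsub_eq_zero_iff_le] using hratio)
  rw [ENNReal.tsum_sigma']
  refine ENNReal.tsum_le_tsum fun n => ?_
  simp only [tsum_fintype]
  grw [Finset.sum_le_sum fun j _ =>
    ENNReal.div_le_div_right (lintegral_edist_dyadic_rpow_le hX n (j : Fin (2 ^ n))) _]
  refine le_of_eq ?_
  rw [Finset.sum_const, Finset.card_univ, Fintype.card_fin, nsmul_eq_mul, Nat.cast_pow,
    Nat.cast_ofNat, ENNReal.coe_pow, ENNReal.coe_rpow_of_ne_zero two_ne_zero, div_eq_mul_inv,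
    ← ENNReal.rpow_neg, mul_assoc (M : ℝ≥0∞), mul_left_comm, ENNReal.coe_ofNat]
  simp only [← ENNReal.rpow_natCast, ← ENNReal.rpow_mul]
  rw [← ENNReal.rpow_add _ _ two_ne_zero ENNReal.ofNat_ne_top,
    ← ENNReal.rpow_add _ _ two_ne_zero ENNReal.ofNat_ne_top]
  ring_nf

lemma ae_exists_dist_dyadic_le (hX : IsAEKolmogorovProcess X P p q M) {h : ℝ}
    (hpq : h * p + 1 < q) :
    ∀ᵐ ω ∂P, ∃ K : ℝ≥0, ∀ n j : ℕ,
      dist (X (Set.projIcc 0 1 zero_le_one (j / 2 ^ n)) ω)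
        (X (Set.projIcc 0 1 zero_le_one ((j + 1) / 2 ^ n)) ω) ≤ K * ((2 : ℝ) ^ (-h)) ^ n := by
  filter_upwards [ae_exists_forall_le_mul_of_tsum_lintegral_ne_top hX.p_pos
    (fun _ => hX.aemeasurable_edist) (fun _ => by positivity)
    (tsum_lintegral_edist_dyadic_ne_top hX hpq)] with ω ⟨K, hK⟩
  refine ⟨K, fun n j => ?_⟩
  obtain hj | hj := lt_or_ge j (2 ^ n)
  · have := hK ⟨n, ⟨j, hj⟩⟩
    rw [← ENNReal.coe_mul, edist_le_coe, ← NNReal.coe_le_coe] at this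
    simpa using this
  · have hj' : (2 : ℝ) ^ n ≤ j := mod_cast hj
    rw [Set.projIcc_of_right_le _ ((one_le_div (by positivity)).2 hj'),
      Set.projIcc_of_right_le _ ((one_le_div (by positivity)).2 (by linarith)), dist_self]
    positivity

lemma ae_exists_holderWith_of_isAEKolmogorovProcess (hX : IsAEKolmogorovProcess X P p q M)
    (hcont : ∀ᵐ ω ∂P, Continuous fun t => X t ω) {h : ℝ≥0} (hh : 0 < h) (hpq : h * p + 1 < q) :
    ∀ᵐ ω ∂P, ∃ C : ℝ≥0, HolderWith C h fun t => X t ω := by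
  filter_upwards [hcont, ae_exists_dist_dyadic_le hX hpq] with ω hω ⟨K, hK⟩
  exact exists_holderWith_of_dist_dyadic_le hω hh hK

end Kolmogorov

section FractionalBrownianMotion

variable {d : ℕ} {Ω : Type*} [MeasurableSpace Ω] {P : Measure Ω} {H : ℝ} {W : I → Ω → E d}

lemma map_eq_map_smul_stdGaussian {ι : Type*} [Fintype ι] [DecidableEq ι]
    {Z : Ω → EuclideanSpace ℝ ι} (hZ : HasGaussianLaw Z P) (hmean : P[Z] = 0) {c : ℝ}
    (hcov : ∀ i j, cov[fun ω => Z ω i, fun ω => Z ω j; P] = if i = j then c ^ 2 else 0) :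
    P.map Z = (stdGaussian (EuclideanSpace ℝ ι)).map
      (c • ContinuousLinearMap.id ℝ (EuclideanSpace ℝ ι)) := by
  have := hZ.isProbabilityMeasure
  have := hZ.isGaussian_map
  have hcoord (i : ι) : MemLp (fun ω => Z ω i) 2 P :=
    (hZ.map_fun (EuclideanSpace.proj i)).memLp_two
  refine IsGaussian.ext ?_ ?_
  · rw [integral_map hZ.aemeasurable (by fun_prop),
      integral_map (by fun_prop) (by fun_prop)]
    have hscale : ∫ z, c • z ∂(stdGaussian (EuclideanSpace ℝ ι)) = 0 := by
      rw [integral_smul, integral_id_stdGaussian, smul_zero]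
    simpa [hmean] using hscale.symm
  · ext x y
    rw [covarianceBilin_map IsGaussian.memLp_two_id, covarianceBilin_stdGaussian]
    refine (covarianceBilin_apply_pi hcoord x y).trans ?_
    have hadjoint : (c • ContinuousLinearMap.id ℝ (EuclideanSpace ℝ ι)).adjoint =
        c • ContinuousLinearMap.id ℝ (EuclideanSpace ℝ ι) := by
      simp [ContinuousLinearMap.adjoint_id]
    have hinner : inner ℝ (c • x) (c • y) = ∑ i, x i * y i * c ^ 2 := by
      simp only [inner_smul_left, inner_smul_right, PiLp.inner_apply, Finset.mul_sum]
      refine Finset.sum_congr rfl fun i _ => ?_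
      simp
      ring
    rw [hadjoint]
    simp only [hcov, mul_ite, mul_zero, Finset.sum_ite_eq, Finset.mem_univ, if_true]
    exact hinner.symm

lemma IsFBM.hasGaussianLaw_sub (hW : IsFBM P H W) (s t : I) :
    HasGaussianLaw (fun ω => W t ω - W s ω) P :=
  hW.gaussian.hasGaussianLaw_fun_sub

lemma IsFBM.memLp_coord (hW : IsFBM P H W) (t : I) (i : Fin d) :
    MemLp (fun ω => W t ω i) 2 P :=
  ((hW.gaussian.hasGaussianLaw_eval t).map_fun (EuclideanSpace.proj i)).memLp_two

lemma IsFBM.cov_sub (hW : IsFBM P H W) (hH : 0 < H) (s t : I) (i j : Fin d) :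
    cov[fun ω => W t ω i - W s ω i, fun ω => W t ω j - W s ω j; P] =
      if i = j then |(t : ℝ) - s| ^ (2 * H) else 0 := by
  have := hW.gaussian.isProbabilityMeasure
  have hLp := hW.memLp_coord
  rw [covariance_fun_sub_fun_sub (hLp t i) (hLp s i) (hLp t j) (hLp s j)]
  simp only [hW.cov]
  split_ifs
  · rw [abs_sub_comm (s : ℝ) t, sub_self, sub_self, abs_zero, Real.zero_rpow (by positivity)]
    ring
  · simp

lemma IsFBM.map_sub (hW : IsFBM P H W) (hH : 0 < H) (s t : I) :
    P.map (fun ω => W t ω - W s ω) = (stdGaussian (E d)).map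
      (|(t : ℝ) - s| ^ H • ContinuousLinearMap.id ℝ (E d)) := by
  refine map_eq_map_smul_stdGaussian (hW.hasGaussianLaw_sub s t) ?_ fun i j => ?_
  · rw [integral_sub (hW.gaussian.hasGaussianLaw_eval t).integrable
      (hW.gaussian.hasGaussianLaw_eval s).integrable, hW.mean, hW.mean, sub_zero]
  · rw [← Real.rpow_mul_natCast (abs_nonneg _), mul_comm H]
    exact hW.cov_sub hH s t i j

lemma IsFBM.lintegral_enorm_sub_rpow (hW : IsFBM P H W) (hH : 0 < H) (s t : I) {r : ℝ}
    (hr : 0 ≤ r) :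
    ∫⁻ ω, ‖W t ω - W s ω‖ₑ ^ r ∂P =
      ENNReal.ofReal (|(t : ℝ) - s| ^ (H * r)) * ∫⁻ z, ‖z‖ₑ ^ r ∂(stdGaussian (E d)) := by
  rw [← lintegral_map' (f := fun z : E d => ‖z‖ₑ ^ r) (by fun_prop)
      (hW.hasGaussianLaw_sub s t).aemeasurable, hW.map_sub hH,
    lintegral_map (by fun_prop) (by fun_prop), ← lintegral_const_mul _ (by fun_prop)]
  refine lintegral_congr fun z => ?_
  rw [smul_apply, ContinuousLinearMap.id_apply, enorm_smul,
    ENNReal.mul_rpow_of_nonneg _ _ hr, Real.rpow_mul (abs_nonneg _),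
    ← ENNReal.ofReal_rpow_of_nonneg (by positivity) hr, Real.enorm_of_nonneg (by positivity)]

lemma lintegral_enorm_rpow_ne_top_of_isGaussian {V : Type*} [NormedAddCommGroup V]
    [NormedSpace ℝ V] [MeasurableSpace V] [BorelSpace V] [SecondCountableTopology V]
    [CompleteSpace V] (μ : Measure V) [IsGaussian μ] {r : ℝ} (hr : 0 < r) :
    ∫⁻ z, ‖z‖ₑ ^ r ∂μ ≠ ∞ := by
  have hmem := IsGaussian.memLp_id μ (ENNReal.ofReal r) ENNReal.ofReal_ne_top
  have := lintegral_rpow_enorm_lt_top_of_eLpNorm_lt_top (by simpa using hr) (by simp) hmem.2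
  simpa [ENNReal.toReal_ofReal hr.le] using this.ne

lemma lintegral_enorm_stdGaussian_ne_zero {V : Type*} [NormedAddCommGroup V]
    [InnerProductSpace ℝ V] [FiniteDimensional ℝ V] [MeasurableSpace V] [BorelSpace V]
    [Nontrivial V] : ∫⁻ z, ‖z‖ₑ ∂(stdGaussian V) ≠ 0 := by
  intro hzero
  rw [lintegral_eq_zero_iff (by fun_prop)] at hzero
  obtain ⟨v, hv⟩ := exists_ne (0 : V)
  have hvar : Var[innerSL ℝ v; stdGaussian V] = 0 := by
    have hcongr : innerSL ℝ v =ᵐ[stdGaussian V] 0 := by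
      filter_upwards [hzero] with z hz
      simp [enorm_eq_zero.1 hz]
    rw [variance_congr hcongr, variance_zero]
  rw [variance_dual_stdGaussian, innerSL_apply_norm] at hvar
  simp [hv] at hvar

lemma IsFBM.ae_zero (hW : IsFBM P H W) (hH : 0 < H) : ∀ᵐ ω ∂P, W 0 ω = 0 := by
  have hlaw := hW.gaussian.hasGaussianLaw_eval 0
  have := map_eq_map_smul_stdGaussian (c := 0) hlaw (hW.mean 0) fun i j => by
    rw [hW.cov]
    simp [hH.ne']
  refine ae_of_ae_map (p := fun z => z = 0) hlaw.aemeasurable ?_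
  rw [this]
  exact (ae_map_iff (by fun_prop) (measurableSet_singleton (0 : E d))).2 <|
    ae_of_all _ fun z => zero_smul ℝ z

lemma IsFBM.isAEKolmogorovProcess (hW : IsFBM P H W) (hH : 0 < H) {r : ℝ} (hr : 0 < r) :
    IsAEKolmogorovProcess W P r (H * r) (∫⁻ z, ‖z‖ₑ ^ r ∂(stdGaussian (E d))).toNNReal := by
  have haemeas (t : I) := (hW.gaussian.hasGaussianLaw_eval t).aemeasurable
  refine ⟨fun t => (haemeas t).mk, .mk_of_secondCountableTopology
    (fun t => (haemeas t).measurable_mk) (fun s t => ?_) hr (by positivity),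
    fun t => (haemeas t).ae_eq_mk⟩
  refine le_of_eq ?_
  calc ∫⁻ ω, edist ((haemeas s).mk _ ω) ((haemeas t).mk _ ω) ^ r ∂P
      = ∫⁻ ω, ‖W s ω - W t ω‖ₑ ^ r ∂P := lintegral_congr_ae <| by
        filter_upwards [(haemeas s).ae_eq_mk, (haemeas t).ae_eq_mk] with ω hs ht
        rw [← hs, ← ht, edist_eq_enorm_sub]
    _ = (∫⁻ z, ‖z‖ₑ ^ r ∂(stdGaussian (E d))).toNNReal * edist s t ^ (H * r) := by
        rw [hW.lintegral_enorm_sub_rpow hH _ _ hr.le, ENNReal.coe_toNNReal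
          (lintegral_enorm_rpow_ne_top_of_isGaussian _ hr), mul_comm, edist_dist, Subtype.dist_eq,
          Real.dist_eq, ENNReal.ofReal_rpow_of_nonneg (abs_nonneg _) (by positivity)]

lemma IsFBM.ae_exists_holderWith (hW : IsFBM P H W) {h : ℝ≥0} (hh : 0 < h) (hhH : h < H) :
    ∀ᵐ ω ∂P, ∃ C : ℝ≥0, HolderWith C h fun t => W t ω := by
  have hH : 0 < H := h.coe_nonneg.trans_lt hhH
  have hgap : 0 < H - h := sub_pos.2 hhH
  refine ae_exists_holderWith_of_isAEKolmogorovProcess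
    (hW.isAEKolmogorovProcess hH (r := 2 / (H - h)) (by positivity)) hW.continuous hh ?_
  field_simp
  linarith

end FractionalBrownianMotion

section Truncation

variable {Ω : Type*} [MeasurableSpace Ω] {P : Measure Ω}

lemma le_min_add_sq_div (a : ℝ≥0∞) {L : ℝ≥0∞} (hL : L ≠ 0) (hL' : L ≠ ∞) :
    a ≤ min a L + a ^ 2 / L := by
  rcases le_total a L with h | h
  · rw [min_eq_left h]
    exact le_self_add
  · refine le_add_left ?_
    rw [ENNReal.le_div_iff_mul_le (.inl hL) (.inl hL'), sq]
    gcongr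

lemma tendsto_lintegral_zero_of_lintegral_sq_le [IsFiniteMeasure P] {T : ℕ → Ω → ℝ≥0∞}
    (hT : ∀ m, AEMeasurable (T m) P) (hlim : ∀ᵐ ω ∂P, Tendsto (T · ω) atTop (𝓝 0)) {M : ℝ≥0∞}
    (hM : M ≠ ∞) (hsq : ∀ᶠ m in atTop, ∫⁻ ω, T m ω ^ 2 ∂P ≤ M) :
    Tendsto (fun m => ∫⁻ ω, T m ω ∂P) atTop (𝓝 0) := by
  have htrunc (n : ℕ) : Tendsto (fun m => ∫⁻ ω, min (T m ω) n ∂P) atTop (𝓝 0) := by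
    rw [← lintegral_zero (μ := P)]
    refine tendsto_lintegral_of_dominated_convergence' (fun _ => (n : ℝ≥0∞))
      (fun m => (hT m).min aemeasurable_const) (fun m => ae_of_all _ fun ω => min_le_right _ _)
      (by simp [ENNReal.mul_eq_top]) ?_
    filter_upwards [hlim] with ω hω
    simpa using hω.min (tendsto_const_nhds (x := (n : ℝ≥0∞)))
  have hbound {n : ℕ} (hn : 0 < n) :
      ∀ᶠ m in atTop, ∫⁻ ω, T m ω ∂P ≤ (∫⁻ ω, min (T m ω) n ∂P) + M / n := by
    filter_upwards [hsq] with m hm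
    calc ∫⁻ ω, T m ω ∂P ≤ ∫⁻ ω, (min (T m ω) n + T m ω ^ 2 / n) ∂P :=
          lintegral_mono fun ω => le_min_add_sq_div _ (by simpa using hn.ne') (by simp)
      _ = (∫⁻ ω, min (T m ω) n ∂P) + (∫⁻ ω, T m ω ^ 2 ∂P) / n := by
          rw [lintegral_add_left' ((hT m).min aemeasurable_const)]
          simp_rw [div_eq_mul_inv]
          rw [lintegral_mul_const'' _ ((hT m).pow_const _)]
      _ ≤ (∫⁻ ω, min (T m ω) n ∂P) + M / n := by gcongr
  have htail : Tendsto (fun n : ℕ => M / n) atTop (𝓝 0) := by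
    simpa [div_eq_mul_inv] using
      ENNReal.Tendsto.const_mul (a := M) ENNReal.tendsto_inv_nat_nhds_zero (.inr hM)
  refine ENNReal.tendsto_nhds_zero.2 fun ε hε => ?_
  have hε2 : 0 < ε / 2 := ENNReal.half_pos hε.ne'
  obtain ⟨n, hnε, hn⟩ :=
    ((ENNReal.tendsto_nhds_zero.1 htail _ hε2).and (eventually_gt_atTop 0)).exists
  filter_upwards [hbound hn, ENNReal.tendsto_nhds_zero.1 (htrunc n) _ hε2] with m hm hmε
  exact hm.trans ((add_le_add hmε hnε).trans_eq (ENNReal.add_halves ε))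

end Truncation

section GridVariation

variable {H : ℝ} {m : ℕ}

/-- The points `j m^{-1/H}`, `j ≤ m`, truncated at `1`. Over a step of this grid a fractional
Brownian motion of Hurst parameter `H` typically moves by `1 / m`, although the `m` steps together
only cover the interval `[0, m^{1-1/H}]`. -/
def grid (H : ℝ) (m j : ℕ) : I := Set.projIcc 0 1 zero_le_one (j * (m : ℝ) ^ (-(1 / H)))

lemma monotone_grid (H : ℝ) (m : ℕ) : Monotone (grid H m) := fun _ _ hjk =>
  Set.monotone_projIcc _ (by gcongr)

lemma coe_grid (hH0 : 0 < H) (hH1 : H ≤ 1) {j : ℕ} (hj : j ≤ m) :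
    (grid H m j : ℝ) = j * (m : ℝ) ^ (-(1 / H)) := by
  rcases Nat.eq_zero_or_pos m with rfl | hm
  · simp [grid, Nat.le_zero.1 hj]
  have hm' : (1 : ℝ) ≤ m := by exact_mod_cast hm
  have hHinv : 1 ≤ 1 / H := by rwa [le_div_iff₀ hH0, one_mul]
  have hle : (j : ℝ) * (m : ℝ) ^ (-(1 / H)) ≤ 1 := by
    calc (j : ℝ) * (m : ℝ) ^ (-(1 / H)) ≤ m * (m : ℝ) ^ (-1 : ℝ) := by gcongr
      _ = 1 := by rw [Real.rpow_neg_one, mul_inv_cancel₀ (by positivity)]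
  rw [grid, Set.projIcc_of_mem zero_le_one ⟨by positivity, hle⟩]

lemma coe_grid_self (hH0 : 0 < H) (hH1 : H ≤ 1) (hm : 0 < m) :
    (grid H m m : ℝ) = (m : ℝ) ^ (1 - 1 / H) := by
  have hm' : (0 : ℝ) < m := by exact_mod_cast hm
  rw [coe_grid hH0 hH1 le_rfl, sub_eq_add_neg, Real.rpow_add hm', Real.rpow_one]

lemma tendsto_grid_self (hH0 : 0 < H) (hH1 : H < 1) :
    Tendsto (fun m => grid H m m) atTop (𝓝 0) := by
  have hlt : 0 < 1 / H - 1 := by rwa [sub_pos, lt_div_iff₀ hH0, one_mul]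
  rw [tendsto_subtype_rng]
  refine ((tendsto_rpow_neg_atTop hlt).comp tendsto_natCast_atTop_atTop).congr' ?_
  filter_upwards [eventually_gt_atTop 0] with m hm
  rw [coe_grid_self hH0 hH1.le hm, Function.comp_apply, neg_sub]

lemma tendsto_setLIntegral_grid {V : Type*} [NormedAddCommGroup V] {g : I → V}
    (hg : Integrable g) (hH0 : 0 < H) (hH1 : H < 1) :
    Tendsto (fun m => ∫⁻ r in Set.Iic (grid H m m), ‖g r‖ₑ) atTop (𝓝 0) := by
  refine tendsto_setLIntegral_zero hg.2.ne ?_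
  have hlim := ENNReal.tendsto_ofReal
    ((continuous_subtype_val.tendsto _).comp (tendsto_grid_self hH0 hH1))
  simpa [Function.comp_def] using hlim

/-- The variation of the path `w` along the first `m` steps of the grid of mesh `m^{-1/H}`. -/
def gridVariation {V : Type*} [NormedAddCommGroup V] (H : ℝ) (m : ℕ) (w : I → V) : ℝ≥0∞ :=
  ∑ j ∈ Finset.range m, ‖w (grid H m (j + 1)) - w (grid H m j)‖ₑ

variable {d : ℕ} {Ω : Type*} [MeasurableSpace Ω] {P : Measure Ω} {W : I → Ω → E d}

lemma IsFBM.lintegral_enorm_grid_sub_rpow (hW : IsFBM P H W) (hH0 : 0 < H) (hH1 : H ≤ 1) {j : ℕ}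
    (hj : j < m) {r : ℝ} (hr : 0 ≤ r) :
    ∫⁻ ω, ‖W (grid H m (j + 1)) ω - W (grid H m j) ω‖ₑ ^ r ∂P =
      (m : ℝ≥0∞) ^ (-r) * ∫⁻ z, ‖z‖ₑ ^ r ∂(stdGaussian (E d)) := by
  have hm : (0 : ℝ) < m := by exact_mod_cast j.zero_le.trans_lt hj
  have hstep : (grid H m (j + 1) : ℝ) - grid H m j = (m : ℝ) ^ (-(1 / H)) := by
    rw [coe_grid hH0 hH1 hj, coe_grid hH0 hH1 hj.le]
    push_cast
    ring
  rw [hW.lintegral_enorm_sub_rpow hH0 _ _ hr, hstep, abs_of_pos (by positivity),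
    ← Real.rpow_mul hm.le, ← ENNReal.ofReal_natCast, ENNReal.ofReal_rpow_of_pos hm]
  congr 3
  field_simp

lemma IsFBM.aemeasurable_gridVariation (hW : IsFBM P H W) (m : ℕ) :
    AEMeasurable (fun ω => gridVariation H m (W · ω)) P :=
  Finset.aemeasurable_fun_sum _ fun _ _ => (hW.hasGaussianLaw_sub _ _).aemeasurable.enorm

lemma IsFBM.lintegral_gridVariation (hW : IsFBM P H W) (hH0 : 0 < H) (hH1 : H ≤ 1) (hm : 0 < m) :
    ∫⁻ ω, gridVariation H m (W · ω) ∂P = ∫⁻ z, ‖z‖ₑ ∂(stdGaussian (E d)) := by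
  have hincr (j : ℕ) (hj : j ∈ Finset.range m) :=
    hW.lintegral_enorm_grid_sub_rpow hH0 hH1 (Finset.mem_range.1 hj) zero_le_one
  simp only [ENNReal.rpow_one, ENNReal.rpow_neg_one] at hincr
  simp only [gridVariation]
  rw [lintegral_finsetSum' _ fun _ _ => (hW.hasGaussianLaw_sub _ _).aemeasurable.enorm,
    Finset.sum_congr rfl hincr, Finset.sum_const, Finset.card_range, nsmul_eq_mul, ← mul_assoc,
    ENNReal.mul_inv_cancel (by simpa using hm.ne') (by simp), one_mul]

lemma IsFBM.lintegral_gridVariation_sq_le (hW : IsFBM P H W) (hH0 : 0 < H) (hH1 : H ≤ 1)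
    (hm : 0 < m) :
    ∫⁻ ω, gridVariation H m (W · ω) ^ 2 ∂P ≤ ∫⁻ z, ‖z‖ₑ ^ 2 ∂(stdGaussian (E d)) := by
  have hincr (j : ℕ) (hj : j ∈ Finset.range m) :=
    hW.lintegral_enorm_grid_sub_rpow hH0 hH1 (Finset.mem_range.1 hj) zero_le_two
  simp only [ENNReal.rpow_two, ENNReal.rpow_neg] at hincr
  have hm0 : (m : ℝ≥0∞) ^ 2 ≠ 0 := by simpa using hm.ne'
  calc ∫⁻ ω, gridVariation H m (W · ω) ^ 2 ∂P
      ≤ ∫⁻ ω, m * ∑ j ∈ Finset.range m, ‖W (grid H m (j + 1)) ω - W (grid H m j) ω‖ₑ ^ 2 ∂P := by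
        refine lintegral_mono fun ω => ?_
        have := ENNReal.rpow_sum_le_const_mul_sum_rpow (Finset.range m)
          (fun j => ‖W (grid H m (j + 1)) ω - W (grid H m j) ω‖ₑ) one_le_two
        rw [Finset.card_range, show (2 : ℝ) - 1 = 1 by norm_num, ENNReal.rpow_one] at this
        simpa only [gridVariation, ENNReal.rpow_two] using this
    _ = m * ∑ j ∈ Finset.range m, ((m : ℝ≥0∞) ^ 2)⁻¹ * ∫⁻ z, ‖z‖ₑ ^ 2 ∂(stdGaussian (E d)) := by
        have haemeas (j : ℕ) : AEMeasurable
            (fun ω => ‖W (grid H m (j + 1)) ω - W (grid H m j) ω‖ₑ ^ 2) P :=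
          (hW.hasGaussianLaw_sub _ _).aemeasurable.enorm.pow_const 2
        rw [lintegral_const_mul'' _ (by fun_prop), lintegral_finsetSum' _ fun j _ => haemeas j,
          Finset.sum_congr rfl hincr]
    _ = ∫⁻ z, ‖z‖ₑ ^ 2 ∂(stdGaussian (E d)) := by
        rw [Finset.sum_const, Finset.card_range, nsmul_eq_mul, ← mul_assoc, ← mul_assoc, ← sq,
          ENNReal.mul_inv_cancel hm0 (by simp), one_mul]

lemma IsFBM.not_ae_tendsto_gridVariation (hW : IsFBM P H W) (hd : 0 < d) (hH0 : 0 < H)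
    (hH1 : H ≤ 1) : ¬ ∀ᵐ ω ∂P, Tendsto (fun m => gridVariation H m (W · ω)) atTop (𝓝 0) := by
  intro hlim
  have := hW.gaussian.isProbabilityMeasure
  have : Nonempty (Fin d) := ⟨0, hd⟩
  have hmoment : ∫⁻ z, ‖z‖ₑ ^ 2 ∂(stdGaussian (E d)) ≠ ∞ := by
    simpa using lintegral_enorm_rpow_ne_top_of_isGaussian (stdGaussian (E d)) two_pos
  have hzero := tendsto_lintegral_zero_of_lintegral_sq_le hW.aemeasurable_gridVariation hlim
    hmoment <| by
      filter_upwards [eventually_gt_atTop 0] with m hm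
      exact hW.lintegral_gridVariation_sq_le hH0 hH1 hm
  refine lintegral_enorm_stdGaussian_ne_zero (V := E d) (tendsto_nhds_unique ?_ hzero)
  refine tendsto_const_nhds.congr' ?_
  filter_upwards [eventually_gt_atTop 0] with m hm
  exact (hW.lintegral_gridVariation hH0 hH1 hm).symm

end GridVariation

section PerturbedEquation

variable {V : Type*} [NormedAddCommGroup V] [NormedSpace ℝ V] {b : I → V → V} {w Y : I → V}

lemma continuous_setIntegral_Iic {g : I → V} (hg : Integrable g) :
    Continuous fun t => ∫ r in Set.Iic t, g r := by
  refine continuous_iff_continuousAt.2 fun t => ?_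
  simp only [ContinuousAt, ← integral_indicator measurableSet_Iic]
  refine tendsto_integral_filter_of_dominated_convergence (fun r => ‖g r‖)
    (.of_forall fun s => hg.1.indicator measurableSet_Iic)
    (.of_forall fun s => ae_of_all _ fun r => norm_indicator_le_norm_self _ _) hg.norm ?_
  filter_upwards [Measure.ae_ne volume t] with r hr
  refine tendsto_const_nhds.congr' ?_
  rcases hr.lt_or_gt with h | h
  · filter_upwards [Ioi_mem_nhds h] with s hs
    rw [Set.indicator_of_mem (Set.mem_Iic.2 h.le), Set.indicator_of_mem (Set.mem_Iic.2 hs.out.le)]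
  · filter_upwards [Iio_mem_nhds h] with s hs
    rw [Set.indicator_of_notMem (Set.notMem_Iic.2 h), Set.indicator_of_notMem (Set.notMem_Iic.2 hs)]

/-- `Y` solves the equation `Y_t = ∫_0^t b_r(Y_r) dr + w_t`, `t ∈ [0,1]`, with drift `b` and
perturbation `w`. Integrability is part of the notion because the Bochner integral of a
non-integrable function is `0`. -/
structure IsPerturbedSolution (b : I → V → V) (w Y : I → V) : Prop where
  integrable : Integrable fun r => b r (Y r)
  eq : ∀ t, Y t = (∫ r in Set.Iic t, b r (Y r)) + w t

lemma IsPerturbedSolution.continuous (hY : IsPerturbedSolution b w Y) (hw : Continuous w) :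
    Continuous Y := by
  rw [funext hY.eq]
  exact (continuous_setIntegral_Iic hY.integrable).add hw

lemma IsPerturbedSolution.apply_zero (hY : IsPerturbedSolution b w Y) : Y 0 = w 0 := by
  rw [hY.eq, setIntegral_measure_zero _ (by simp), zero_add]

lemma IsPerturbedSolution.sub_eq (hY : IsPerturbedSolution b w Y) {s t : I} (hst : s ≤ t) :
    Y t - Y s = (∫ r in Set.Ioc s t, b r (Y r)) + (w t - w s) := by
  rw [hY.eq t, hY.eq s, ← Set.Iic_union_Ioc_eq_Iic hst,
    setIntegral_union (Set.Iic_disjoint_Ioc le_rfl) measurableSet_Ioc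
      hY.integrable.integrableOn hY.integrable.integrableOn]
  abel

lemma IsPerturbedSolution.enorm_sub_le (hY : IsPerturbedSolution b w Y) {s t : I} (hst : s ≤ t)
    {R : ℝ≥0∞} (hs : ‖Y s‖ₑ ≤ R) (ht : ‖Y t‖ₑ ≤ R) :
    ‖w t - w s‖ₑ ≤ 2 * R + ∫⁻ r in Set.Ioc s t, ‖b r (Y r)‖ₑ := by
  have hincr : w t - w s = (Y t - Y s) - ∫ r in Set.Ioc s t, b r (Y r) := by
    rw [hY.sub_eq hst, add_sub_cancel_left]
  calc ‖w t - w s‖ₑ ≤ ‖Y t‖ₑ + ‖Y s‖ₑ + ‖∫ r in Set.Ioc s t, b r (Y r)‖ₑ := by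
        rw [hincr]
        exact _root_.enorm_sub_le.trans (add_le_add_left _root_.enorm_sub_le _)
    _ ≤ 2 * R + ∫⁻ r in Set.Ioc s t, ‖b r (Y r)‖ₑ := by
        rw [two_mul]
        gcongr
        exact enorm_integral_le_lintegral_enorm _

lemma IsPerturbedSolution.sum_enorm_sub_le (hY : IsPerturbedSolution b w Y) {τ : ℕ → I}
    (hτ : Monotone τ) {R : ℝ≥0∞} {m : ℕ} (hR : ∀ j ≤ m, ‖Y (τ j)‖ₑ ≤ R) :
    ∑ j ∈ Finset.range m, ‖w (τ (j + 1)) - w (τ j)‖ₑ ≤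
      2 * m * R + ∫⁻ r in Set.Iic (τ m), ‖b r (Y r)‖ₑ := by
  induction m with
  | zero => simp
  | succ m ih =>
    have hle : τ m ≤ τ (m + 1) := hτ m.le_succ
    have hlast := hY.enorm_sub_le hle (hR m m.le_succ) (hR (m + 1) le_rfl)
    rw [Finset.sum_range_succ, ← Set.Iic_union_Ioc_eq_Iic hle,
      lintegral_union measurableSet_Ioc (Set.Iic_disjoint_Ioc le_rfl)]
    refine (add_le_add (ih fun j hj => hR j (hj.trans m.le_succ)) hlast).trans_eq ?_
    push_cast
    ring

lemma IsPerturbedSolution.tendsto_gridVariation (hY : IsPerturbedSolution b w Y) {H γ : ℝ}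
    (hH0 : 0 < H) (hH1 : H < 1) (hγ : H < (1 - H) * γ) (hYγ : Y =O[𝓝 0] fun t => (t : ℝ) ^ γ) :
    Tendsto (fun m => gridVariation H m w) atTop (𝓝 0) := by
  obtain ⟨C, hC, hbound⟩ := hYγ.exists_nonneg
  have hγ0 : 0 < γ := pos_of_mul_pos_right (hH0.trans hγ) (by linarith)
  have hle : ∀ᶠ m : ℕ in atTop, gridVariation H m w ≤
      ENNReal.ofReal (2 * C * (m : ℝ) ^ (1 + (1 - 1 / H) * γ)) +
        ∫⁻ r in Set.Iic (grid H m m), ‖b r (Y r)‖ₑ := by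
    filter_upwards [(tendsto_const_nhds.Icc (tendsto_grid_self hH0 hH1)).eventually
      hbound.bound.smallSets, eventually_gt_atTop 0] with m hm hm0
    have hm0' : (0 : ℝ) < m := by exact_mod_cast hm0
    have hgrid (j : ℕ) (hj : j ≤ m) :
        ‖Y (grid H m j)‖ₑ ≤ ENNReal.ofReal (C * (grid H m m : ℝ) ^ γ) := by
      have hjm : grid H m j ≤ grid H m m := monotone_grid H m hj
      have hj0 : (0 : ℝ) ≤ grid H m j := (grid H m j).2.1
      rw [← ofReal_norm]
      refine ENNReal.ofReal_le_ofReal ((hm _ ⟨hj0, hjm⟩).trans ?_)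
      rw [Real.norm_of_nonneg (by positivity)]
      gcongr
    refine (hY.sum_enorm_sub_le (monotone_grid H m) hgrid).trans_eq ?_
    rw [coe_grid_self hH0 hH1.le hm0, ← Real.rpow_mul hm0'.le, Real.rpow_add hm0', Real.rpow_one,
      show 2 * C * (m * (m : ℝ) ^ ((1 - 1 / H) * γ)) = 2 * m * (C * (m : ℝ) ^ ((1 - 1 / H) * γ))
        by ring, ENNReal.ofReal_mul (p := 2 * m) (by positivity)]
    simp
  have hexp : 0 < -(1 + (1 - 1 / H) * γ) := by
    rw [show -(1 + (1 - 1 / H) * γ) = ((1 - H) * γ - H) / H by field_simp; ring]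
    exact div_pos (by linarith) hH0
  have hpow := ENNReal.tendsto_ofReal
    (((tendsto_rpow_neg_atTop hexp).comp tendsto_natCast_atTop_atTop).const_mul (2 * C))
  refine tendsto_of_tendsto_of_tendsto_of_le_of_le' tendsto_const_nhds ?_
    (.of_forall fun _ => zero_le) hle
  simpa [Function.comp_def] using hpow.add (tendsto_setLIntegral_grid hY.integrable hH0 hH1)

end PerturbedEquation

section RadialDrift

variable {V : Type*} [NormedAddCommGroup V] [NormedSpace ℝ V]

/-- The vector field `y ↦ -‖y‖^{-α} y / ‖y‖` on the closed unit ball, extended by `0`. -/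
def radialField (α : ℝ) (y : V) : V :=
  if ‖y‖ ≤ 1 then -‖y‖ ^ (-α - 1) • y else 0

/-- The drift `b_t(y) = -t^{-β} ‖y‖^{-α} y / ‖y‖`, `‖y‖ ≤ 1`. It points to the origin and is
singular both at `t = 0` and at `y = 0`. -/
def radialDrift (α β : ℝ) (t : I) (y : V) : V := (t : ℝ) ^ (-β) • radialField α y

lemma norm_radialField_le (α : ℝ) (y : V) :
    ‖radialField α y‖ ≤ ‖y‖ ^ (-α) := by
  rcases eq_or_ne y 0 with rfl | hy
  · simpa [radialField] using Real.rpow_nonneg le_rfl _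
  have hy0 : 0 < ‖y‖ := norm_pos_iff.2 hy
  rw [radialField]
  split_ifs
  · rw [norm_smul, norm_neg, Real.norm_of_nonneg (by positivity), Real.rpow_sub_one hy0.ne',
      div_mul_cancel₀ _ hy0.ne']
  · rw [norm_zero]
    positivity

lemma measurable_radialField [MeasurableSpace V] [BorelSpace V] [SecondCountableTopology V]
    (α : ℝ) : Measurable (radialField α : V → V) :=
  Measurable.ite (measurableSet_le measurable_norm measurable_const) (by fun_prop)
    measurable_const

lemma memLp_radialField [FiniteDimensional ℝ V] [Nontrivial V] [MeasurableSpace V] [BorelSpace V]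
    {μ : Measure V} [μ.IsAddHaarMeasure] {α p : ℝ} (hp : 0 < p)
    (hα : α < Module.finrank ℝ V / p) :
    MemLp (radialField α : V → V) (ENNReal.ofReal p) μ := by
  have hm : Measurable (radialField α : V → V) := measurable_radialField α
  rw [← integrable_norm_rpow_iff hm.aestronglyMeasurable (by simpa using hp) (by simp),
    ENNReal.toReal_ofReal hp.le]
  have hball : IntegrableOn (fun y : V => ‖radialField α y‖ ^ p) (Metric.ball 0 2) μ := by
    refine integrableOn_ball_of_norm_le_rpow (C := 1) Module.finrank_pos ((lt_div_iff₀ hp).1 hα)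
      (ae_of_all _ fun y => ?_) (hm.norm.pow_const p).aestronglyMeasurable
    calc ‖‖radialField α y‖ ^ p‖ = ‖radialField α y‖ ^ p := Real.norm_of_nonneg (by positivity)
      _ ≤ (‖y‖ ^ (-α)) ^ p := by
          gcongr
          exact norm_radialField_le α y
      _ = 1 * ‖y‖ ^ (-(α * p)) := by rw [← Real.rpow_mul (norm_nonneg _), neg_mul, one_mul]
  refine (integrableOn_iff_integrable_of_support_subset fun y hy => ?_).1 hball
  by_contra hy2
  have hy1 : ¬ ‖y‖ ≤ 1 := by
    rw [mem_ball_zero_iff] at hy2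
    linarith
  simp [radialField, hy1, Real.zero_rpow hp.ne'] at hy

lemma memLp_rpow_neg {β q : ℝ} (hq : 0 < q) (hβ : β < 1 / q) :
    MemLp (fun t : I => (t : ℝ) ^ (-β)) (ENNReal.ofReal q) := by
  have hm : Measurable fun t : I => (t : ℝ) ^ (-β) := by fun_prop
  rw [← integrable_norm_rpow_iff hm.aestronglyMeasurable (by simpa using hq) (by simp),
    ENNReal.toReal_ofReal hq.le]
  have hβq : -1 < -(β * q) := neg_lt_neg ((lt_div_iff₀ hq).1 hβ)
  have hint := intervalIntegral.intervalIntegrable_rpow' (a := 0) (b := 1) hβq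
  rw [intervalIntegrable_iff_integrableOn_Icc_of_le zero_le_one] at hint
  refine ((unitInterval.measurePreserving_coe.integrable_comp_emb
    unitInterval.measurableEmbedding_coe).2 hint).congr (ae_of_all _ fun t => ?_)
  have ht : 0 ≤ (t : ℝ) := t.2.1
  simp only [Function.comp_apply]
  rw [Real.norm_of_nonneg (by positivity), ← Real.rpow_mul ht, neg_mul]

lemma memMixedLp_smul {d : ℕ} {p q : ℝ} {f : I → ℝ} {g : E d → E d} (hf : Measurable f)
    (hg : Measurable g) (hfq : MemLp f (ENNReal.ofReal q)) (hgp : MemLp g (ENNReal.ofReal p)) :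
    MemMixedLp q p fun t y => f t • g y := by
  refine ⟨(hf.comp measurable_fst).smul (hg.comp measurable_snd), ?_⟩
  have hslice (t : I) : eLpNorm (fun y => f t • g y) (ENNReal.ofReal p) volume =
      ‖(eLpNorm g (ENNReal.ofReal p) volume).toReal * f t‖ₑ := by
    rw [enorm_mul, Real.enorm_of_nonneg ENNReal.toReal_nonneg, ENNReal.ofReal_toReal hgp.2.ne,
      mul_comm]
    exact eLpNorm_const_smul (f t) g _ _
  simp_rw [hslice]
  rw [eLpNorm_enorm]
  exact (hfq.const_mul _).2

lemma memMixedLp_radialDrift {d : ℕ} (hd : 0 < d) {α β p q : ℝ} (hp : 0 < p) (hq : 0 < q)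
    (hα : α < d / p) (hβ : β < 1 / q) (x : E d) :
    MemMixedLp q p fun t y => radialDrift α β t (y - x) := by
  have : Nonempty (Fin d) := ⟨0, hd⟩
  have hfield : MemLp (radialField (V := E d) α) (ENNReal.ofReal p) :=
    memLp_radialField hp (by rwa [finrank_euclideanSpace_fin])
  exact memMixedLp_smul (by fun_prop) ((measurable_radialField α).comp (measurable_sub_const x))
    (memLp_rpow_neg hq hβ) (hfield.comp_measurePreserving (measurePreserving_sub_right _ x))

end RadialDrift

section AttractedPath

variable {V : Type*} [NormedAddCommGroup V] [InnerProductSpace ℝ V]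
variable {α β : ℝ} {K h : ℝ≥0} {w Y : I → V} {u : I}

lemma inner_radialDrift_le (hα : 0 ≤ α) (hβ : 0 ≤ β) {r : I} (hr0 : 0 < r) (hru : r ≤ u) {v y : V}
    (hy : y ≠ 0) (hyv : ‖y‖ ≤ ‖v‖) (hv : ‖v‖ ≤ 1) (hvy : ‖v‖ ^ 2 / 2 ≤ inner ℝ v y) :
    inner ℝ v (radialDrift α β r y) ≤ -((u : ℝ) ^ (-β) * ‖v‖ ^ (-α - 1) * (‖v‖ ^ 2 / 2)) := by
  have hr0' : (0 : ℝ) < r := hr0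
  have hy0 : 0 < ‖y‖ := norm_pos_iff.2 hy
  have htime : (u : ℝ) ^ (-β) ≤ (r : ℝ) ^ (-β) :=
    Real.rpow_le_rpow_of_nonpos hr0' hru (by linarith)
  have hspace : ‖v‖ ^ (-α - 1) ≤ ‖y‖ ^ (-α - 1) :=
    Real.rpow_le_rpow_of_nonpos hy0 hyv (by linarith)
  rw [radialDrift, radialField, if_pos (hyv.trans hv), real_inner_smul_right,
    real_inner_smul_right, neg_mul, mul_neg, neg_le_neg_iff, ← mul_assoc]
  gcongr

lemma exists_isLast_le {ι : Type*} [LinearOrder ι] [TopologicalSpace ι] [OrderTopology ι]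
    [CompactIccSpace ι] {f : ι → ℝ} {a b : ι} {c : ℝ} (hf : ContinuousOn f (Set.Icc a b))
    (hab : a ≤ b) (ha : f a ≤ c) (hb : c < f b) :
    ∃ s ∈ Set.Ico a b, f s ≤ c ∧ ∀ r ∈ Set.Ioc s b, c < f r := by
  have hcompact : IsCompact (Set.Icc a b ∩ f ⁻¹' Set.Iic c) :=
    isCompact_Icc.of_isClosed_subset (hf.preimage_isClosed_of_isClosed isClosed_Icc isClosed_Iic)
      Set.inter_subset_left
  obtain ⟨s, ⟨⟨has, hsb⟩, hsc⟩, hmax⟩ :=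
    hcompact.exists_isGreatest ⟨a, Set.left_mem_Icc.2 hab, ha⟩
  have hsb' : s ≠ b := by
    rintro rfl
    exact hb.not_ge hsc
  refine ⟨s, ⟨has, hsb.lt_of_ne hsb'⟩, hsc, fun r ⟨hsr, hrb⟩ => ?_⟩
  by_contra! hrc
  exact hsr.not_ge (hmax ⟨⟨has.trans hsr.le, hrb⟩, hrc⟩)

lemma IsPerturbedSolution.setIntegral_inner_radialDrift_le
    (hY : IsPerturbedSolution (radialDrift α β) w Y) (hα : 0 ≤ α) (hβ : 0 ≤ β) {s : I} (hsu : s ≤ u)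
    (hu1 : ‖Y u‖ ≤ 1) (hmax : ∀ r ≤ u, ‖Y r‖ ≤ ‖Y u‖)
    (hcomp : ∀ r ∈ Set.Ioc s u, ‖Y u‖ ^ 2 / 2 < inner ℝ (Y u) (Y r)) :
    ∫ r in Set.Ioc s u, inner ℝ (Y u) (radialDrift α β r (Y r)) ≤
      -((u - s) * ((u : ℝ) ^ (-β) * ‖Y u‖ ^ (-α - 1) * (‖Y u‖ ^ 2 / 2))) := by
  set κ : ℝ := (u : ℝ) ^ (-β) * ‖Y u‖ ^ (-α - 1) * (‖Y u‖ ^ 2 / 2)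
  calc ∫ r in Set.Ioc s u, inner ℝ (Y u) (radialDrift α β r (Y r))
      ≤ ∫ _ in Set.Ioc s u, -κ := by
        refine setIntegral_mono_on (hY.integrable.integrableOn.const_inner _)
          (integrableOn_const (by simp)) measurableSet_Ioc fun r hr => ?_
        have hYr : Y r ≠ 0 := by
          rintro h0
          have := hcomp r hr
          rw [h0, inner_zero_right] at this
          exact this.not_ge (by positivity)
        exact inner_radialDrift_le hα hβ (s.2.1.trans_lt hr.1) hr.2 hYr (hmax r hr.2) hu1
          (hcomp r hr).le
    _ = -((u - s) * κ) := by
        rw [setIntegral_const, measureReal_def, unitInterval.volume_Ioc,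
          ENNReal.toReal_ofReal (sub_nonneg.2 hsu), smul_eq_mul, mul_neg]

/- Follow `Y` from the last time `s` at which its component along `Y u` was at most `‖Y u‖ / 2`.
On `(s, u]` the drift pushes this component down, so the perturbation has to make up
both for the growth of the component and for the drift. -/
lemma IsPerturbedSolution.exists_norm_add_le [CompleteSpace V]
    (hY : IsPerturbedSolution (radialDrift α β) w Y) (hα : 0 ≤ α) (hβ : 0 ≤ β)
    (hw : HolderWith K h w) (hh : 0 < h) (hw0 : w 0 = 0) (hu : Y u ≠ 0) (hu1 : ‖Y u‖ ≤ 1)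
    (hmax : ∀ r ≤ u, ‖Y r‖ ≤ ‖Y u‖) :
    ∃ τ : ℝ, 0 < τ ∧ ‖Y u‖ + τ * (‖Y u‖ ^ (-α) * (u : ℝ) ^ (-β)) ≤ 2 * K * τ ^ (h : ℝ) := by
  set R := ‖Y u‖ with hR
  have hR0 : 0 < R := norm_pos_iff.2 hu
  have hcont : Continuous fun r => inner ℝ (Y u) (Y r) :=
    continuous_const.inner (hY.continuous (hw.continuous hh))
  obtain ⟨s, ⟨-, hsu⟩, hs, hlast⟩ := exists_isLast_le (a := 0) (b := u) (c := R ^ 2 / 2)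
    hcont.continuousOn u.2.1 (by rw [hY.apply_zero, hw0, inner_zero_right]; positivity)
    (by rw [real_inner_self_eq_norm_sq, ← hR]; linarith [pow_pos hR0 2])
  have hτ : (0 : ℝ) < u - s := sub_pos.2 hsu
  have hdrift := hY.setIntegral_inner_radialDrift_le hα hβ hsu.le hu1 hmax hlast
  have hperturb : inner ℝ (Y u) (w u - w s) ≤ R * (K * ((u : ℝ) - s) ^ (h : ℝ)) := by
    refine (real_inner_le_norm _ _).trans ?_
    have := hw.dist_le u s
    rw [dist_eq_norm, Subtype.dist_eq, Real.dist_eq, abs_of_pos hτ] at this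
    gcongr
  have hκ : (u : ℝ) ^ (-β) * R ^ (-α - 1) * (R ^ 2 / 2) =
      R * (R ^ (-α) * (u : ℝ) ^ (-β)) / 2 := by
    rw [Real.rpow_sub_one hR0.ne']
    field_simp
  have hbalance : R ^ 2 - R ^ 2 / 2 ≤ -((u - s) * (R * (R ^ (-α) * (u : ℝ) ^ (-β)) / 2)) +
      R * (K * ((u : ℝ) - s) ^ (h : ℝ)) := by
    have hincr := congrArg (inner ℝ (Y u)) (hY.sub_eq hsu.le)
    rw [inner_sub_right, inner_add_right, real_inner_self_eq_norm_sq,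
      ← integral_inner hY.integrable.integrableOn] at hincr
    rw [← hR, hκ] at hdrift
    linarith
  refine ⟨u - s, hτ, le_of_mul_le_mul_left ?_ hR0⟩
  linarith

lemma rpow_le_mul_rpow_of_le_mul_rpow {R τ L T h a : ℝ} (hR : 0 < R) (hτ : 0 < τ) (hL : 0 ≤ L)
    (hT : 0 < T) (hh0 : 0 ≤ h) (hh1 : h ≤ 1) (hRτ : R ≤ L * τ ^ h)
    (hτR : τ * (R ^ (-a) * T⁻¹) ≤ L * τ ^ h) : R ^ (1 - h - a * h) ≤ L * T ^ h := by
  have hτ_le : τ ^ (1 - h) ≤ L * R ^ a * T := by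
    rw [Real.rpow_sub hτ, Real.rpow_one, div_le_iff₀ (by positivity)]
    calc τ = τ * (R ^ (-a) * T⁻¹) * (R ^ a * T) := by
          rw [Real.rpow_neg hR.le]
          field_simp
      _ ≤ L * τ ^ h * (R ^ a * T) := by gcongr
      _ = L * R ^ a * T * τ ^ h := by ring
  have hR_le : R ^ (1 - h) ≤ L * T ^ h * R ^ (a * h) := by
    calc R ^ (1 - h) ≤ (L * τ ^ h) ^ (1 - h) := by gcongr
      _ = L ^ (1 - h) * (τ ^ (1 - h)) ^ h := by
        rw [Real.mul_rpow hL (by positivity), ← Real.rpow_mul hτ.le, ← Real.rpow_mul hτ.le,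
          mul_comm h]
      _ ≤ L ^ (1 - h) * (L * R ^ a * T) ^ h := by gcongr
      _ = L ^ (1 - h) * L ^ h * T ^ h * R ^ (a * h) := by
        rw [Real.mul_rpow (by positivity) hT.le, Real.mul_rpow hL (by positivity),
          ← Real.rpow_mul hR.le]
        ring
      _ = L * T ^ h * R ^ (a * h) := by
        rw [← Real.rpow_add' hL (by simp), sub_add_cancel, Real.rpow_one]
  rwa [Real.rpow_sub hR, div_le_iff₀ (by positivity)]

lemma IsPerturbedSolution.norm_le [CompleteSpace V]
    (hY : IsPerturbedSolution (radialDrift α β) w Y) (hα : 0 ≤ α) (hβ : 0 ≤ β)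
    (hw : HolderWith K h w) (hh0 : 0 < h) (hh1 : h ≤ 1) (hw0 : w 0 = 0)
    (hρ : 0 < 1 - h - α * h) {t : I} (hsmall : ∀ r ≤ t, ‖Y r‖ ≤ 1) :
    ‖Y t‖ ≤ (2 * K * (t : ℝ) ^ (β * h)) ^ (1 - h - α * h : ℝ)⁻¹ := by
  have ht : (0 : ℝ) ≤ t := t.2.1
  obtain ⟨u, hut : u ≤ t, hmax⟩ := isClosed_Iic.isCompact.exists_isMaxOn ⟨t, le_refl t⟩
    (hY.continuous (hw.continuous hh0)).norm.continuousOn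
  refine (show ‖Y t‖ ≤ ‖Y u‖ from hmax (le_refl t)).trans ?_
  rcases eq_or_ne (Y u) 0 with hu | hu
  · rw [hu, norm_zero]
    positivity
  have hR : 0 < ‖Y u‖ := norm_pos_iff.2 hu
  have hu0 : (0 : ℝ) < u := by
    refine unitInterval.pos_iff_ne_zero.2 ?_
    rintro rfl
    exact hu (hY.apply_zero.trans hw0)
  obtain ⟨τ, hτ, hle⟩ := hY.exists_norm_add_le hα hβ hw hh0 hw0 hu (hsmall u hut)
    fun r hr => hmax (hr.trans hut)
  rw [Real.rpow_neg hu0.le] at hle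
  have hpush : 0 ≤ τ * (‖Y u‖ ^ (-α) * ((u : ℝ) ^ β)⁻¹) := by positivity
  have hbound := rpow_le_mul_rpow_of_le_mul_rpow hR hτ (by positivity) (by positivity) h.2 hh1
    ((le_add_of_nonneg_right hpush).trans hle) ((le_add_of_nonneg_left hR.le).trans hle)
  refine (Real.le_rpow_inv_iff_of_pos hR.le (by positivity) hρ).2 (hbound.trans ?_)
  rw [← Real.rpow_mul hu0.le]
  gcongr
  exact Real.rpow_le_rpow hu0.le hut (mul_nonneg hβ h.2)

lemma IsPerturbedSolution.isBigO [CompleteSpace V]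
    (hY : IsPerturbedSolution (radialDrift α β) w Y) (hα : 0 ≤ α) (hβ : 0 ≤ β)
    (hw : HolderWith K h w) (hh0 : 0 < h) (hh1 : h ≤ 1) (hw0 : w 0 = 0)
    (hρ : 0 < 1 - h - α * h) :
    Y =O[𝓝 0] fun t => (t : ℝ) ^ (β * h * (1 - h - α * h : ℝ)⁻¹) := by
  have hlim : Tendsto (fun t => ‖Y t‖) (𝓝 0) (𝓝 0) := by
    simpa [hY.apply_zero, hw0] using (hY.continuous (hw.continuous hh0)).norm.tendsto 0
  have hsmall : ∀ᶠ t in 𝓝 (0 : I), ∀ r ≤ t, ‖Y r‖ ≤ 1 := by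
    filter_upwards [(tendsto_const_nhds.Icc tendsto_id).eventually
      (hlim.eventually_le_const one_pos).smallSets] with t ht r hr using ht r ⟨r.2.1, hr⟩
  refine .of_bound ((2 * K : ℝ) ^ (1 - h - α * h : ℝ)⁻¹) ?_
  filter_upwards [hsmall] with t ht
  have ht0 : (0 : ℝ) ≤ t := t.2.1
  refine (hY.norm_le hα hβ hw hh0 hh1 hw0 hρ ht).trans_eq ?_
  rw [Real.mul_rpow (by positivity) (by positivity), ← Real.rpow_mul ht0,
    Real.norm_of_nonneg (by positivity)]

end AttractedPath

lemma exists_exponents {H A B : ℝ} (hH0 : 0 < H) (hH1 : H < 1) (hA : 0 < A) (hB : 0 < B)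
    (hAB : 1 - H < (1 - H) * B + H * A) :
    ∃ α β h : ℝ, 0 ≤ α ∧ α < A ∧ 0 ≤ β ∧ β < B ∧ 0 < h ∧ h < H ∧ 0 < 1 - h - α * h ∧
      H * (1 - h - α * h) < (1 - H) * (β * h) := by
  have hH : 0 < 1 - H := by linarith
  obtain ⟨β, hβ, hβB⟩ : ∃ β, max 0 (1 - H * A / (1 - H)) < β ∧ β < B := by
    refine exists_between (max_lt hB ?_)
    rw [sub_lt_iff_lt_add, ← sub_lt_iff_lt_add', lt_div_iff₀ hH]
    linarith
  obtain ⟨hβ0, hβA⟩ := max_lt_iff.1 hβ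
  have hHA : (1 - β) * (1 - H) < H * A := (lt_div_iff₀ hH).1 (by linarith)
  obtain ⟨α, hα, hα'⟩ : ∃ α, max 0 ((1 - β) * (1 - H) / H) < α ∧ α < min A ((1 - H) / H) := by
    refine exists_between (max_lt (lt_min hA (by positivity)) (lt_min ?_ ?_))
    · rwa [div_lt_iff₀' hH0]
    · gcongr
      exact mul_lt_of_lt_one_left hH (by linarith)
  obtain ⟨hα0, hαβ⟩ := max_lt_iff.1 hα
  obtain ⟨hαA, hαH⟩ := lt_min_iff.1 hα'
  rw [div_lt_iff₀ hH0] at hαβ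
  rw [lt_div_iff₀ hH0] at hαH
  have hG : 1 < H + α * H + β * (1 - H) := by linarith
  obtain ⟨h, hh, hhH⟩ := exists_between (div_lt_self hH0 hG)
  have hh0 : 0 < h := (div_pos hH0 (one_pos.trans hG)).trans hh
  rw [div_lt_iff₀ (one_pos.trans hG)] at hh
  have hαh : α * h ≤ α * H := by gcongr
  exact ⟨α, β, h, hα0.le, hαA, hβ0.le, hβB, hh0, hhH, by linarith, by linarith⟩

lemma IsFBM.not_ae_solves_radialDrift {d : ℕ} {Ω : Type*} [MeasurableSpace Ω] {P : Measure Ω}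
    {H : ℝ} {X W : I → Ω → E d} (hW : IsFBM P H W) (hd : 0 < d) (hH0 : 0 < H) (hH1 : H < 1)
    {α β : ℝ} {h : ℝ≥0} (hα : 0 ≤ α) (hβ : 0 ≤ β) (hh0 : 0 < h) (hhH : h < H)
    (hρ : 0 < 1 - h - α * h) (hβh : H * (1 - h - α * h) < (1 - H) * (β * h)) (x : E d) :
    ¬ ∀ᵐ ω ∂P, Integrable (fun r => radialDrift α β r (X r ω - x)) ∧
      ∀ t, X t ω = x + (∫ r in Set.Iic t, radialDrift α β r (X r ω - x)) + W t ω := by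
  intro hsol
  refine hW.not_ae_tendsto_gridVariation hd hH0 hH1.le ?_
  filter_upwards [hsol, hW.ae_zero hH0, hW.ae_exists_holderWith hh0 hhH]
    with ω ⟨hint, heq⟩ hW0 ⟨K, hK⟩
  have hY : IsPerturbedSolution (radialDrift α β) (W · ω) fun t => X t ω - x :=
    ⟨hint, fun t => by rw [heq t]; abel⟩
  refine hY.tendsto_gridVariation hH0 hH1 ?_
    (hY.isBigO hα hβ hK hh0 (hhH.trans hH1).le hW0 hρ)
  rwa [← mul_assoc, ← div_eq_mul_inv, lt_div_iff₀ hρ]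

lemma pos_dim_of_lt {d : ℕ} {H p q : ℝ} (hH1 : H < 1) (hq : 1 ≤ q)
    (hpq : (1 - H) / q + H * d / p > 1 - H) : 0 < d := by
  refine Nat.pos_of_ne_zero ?_
  rintro rfl
  have hle : (1 - H) / q ≤ 1 - H := div_le_self (by linarith) hq
  simp at hpq
  linarith

end FractionalSDE

end

section Generalization

open MeasureTheory

theorem theorem2p2_general {d : ℕ} (hd : 0 < d) {H p q : ℝ} (hH0 : 0 < H) (hH1 : H < 1)
    (hp : 0 < p) (hq : 0 < q) (hpq : (1 - H) / q + H * d / p > 1 - H) (x : FractionalSDE.E d) :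
    ∃ b : unitInterval → FractionalSDE.E d → FractionalSDE.E d,
      FractionalSDE.MemMixedLp q p b ∧
        ∀ {Ω : Type u} [MeasurableSpace Ω] {P : Measure Ω}
          {X W : unitInterval → Ω → FractionalSDE.E d}, FractionalSDE.IsFBM P H W →
            ¬ ∀ᵐ ω ∂P, Integrable (fun r => b r (X r ω)) ∧
              ∀ t, X t ω = x + (∫ r in Set.Iic t, b r (X r ω)) + W t ω := by
  obtain ⟨α, β, h, hα0, hα, hβ0, hβ, hh0, hhH, hρ, hβh⟩ :=
    FractionalSDE.exists_exponents (A := d / p) (B := 1 / q) hH0 hH1 (by positivity)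
      (by positivity) (by rw [mul_one_div, ← mul_div_assoc]; exact hpq)
  lift h to NNReal using hh0.le
  exact ⟨fun t y => FractionalSDE.radialDrift α β t (y - x),
    FractionalSDE.memMixedLp_radialDrift hd hp hq hα hβ x,
    fun hW => hW.not_ae_solves_radialDrift hd hH0 hH1 hα0 hβ0 hh0 hhH hρ hβh x⟩

end Generalization

theorem theorem2p2 (d : ℕ) (H p q : ℝ) (hH0 : 0 < H) (hH1 : H < 1) (hp : 1 ≤ p) (hq : 1 ≤ q)
    (hpq : (1 - H) / q + H * d / p > 1 - H) (x : FractionalSDE.E d) :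
    ∃ b : unitInterval → FractionalSDE.E d → FractionalSDE.E d,
      FractionalSDE.MemMixedLp q p b ∧ ¬ FractionalSDE.HasWeakSolution.{u} H x b := by
  obtain ⟨b, hb, hnone⟩ := theorem2p2_general (FractionalSDE.pos_dim_of_lt hH1 hq hpq) hH0 hH1
    (one_pos.trans_le hp) (one_pos.trans_le hq) hpq x
  exact ⟨b, hb, fun ⟨_, _, _, _, _, _, hsol⟩ => hnone hsol.fbm.1 hsol.equation⟩
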